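/- Let $m\geq 2$ and let $(x_n)_{n\geq 1}$ be a sequence in the Euclidean space $\mathbb R^m$. Write $S_\infty$ for the group of all permutations of $\mathbb N$. Let $\operatorname{SR}(\sum_{n=1}^\infty x_n)$, the sum range, be the set of all $s\in\mathbb R^m$ such that for some $\sigma\in S_\infty$ the partial sums $\sum_{n=1}^k x_{\sigma(n)}$ converge to $s$ as $k\to\infty$. For $\sigma\in S_\infty$ let $\operatorname{LIM}(\sum_{n=1}^\infty x_{\sigma(n)})$ be the set of all limit points of the sequence $\big(\sum_{n=1}^k x_{\sigma(n)}\big)_{k=1}^\infty$, that is, of all limits of its convergent subsequences. Assume that $\operatorname{SR}(\sum_{n=1}^\infty x_n)=\mathbb R^m$, and let $X\subseteq\mathbb R^m$ be a closed (possibly empty) set all of whose connected components are unbounded. Then there is $\sigma\in S_\infty$ such that $X=\operatorname{LIM}(\sum_{n=1}^\infty x_{\sigma(n)})$. -/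

import Mathlib

open Filter Topology

/-- The `k`-th partial sum `y 0 + ⋯ + y (k - 1)` of the series with terms `y n`. -/
def seriesPartialSum {E : Type*} [AddCommMonoid E] (y : ℕ → E) (k : ℕ) : E :=
  ∑ n ∈ Finset.range k, y n

/-- The sum range `SR(∑ x n)`: all sums of convergent rearrangements of the series
(convergence of the sequence of partial sums, not unconditional summability). -/
def sumRange {E : Type*} [AddCommMonoid E] [TopologicalSpace E] (x : ℕ → E) : Set E :=
  {s | ∃ σ : Equiv.Perm ℕ, Tendsto (seriesPartialSum fun n => x (σ n)) atTop (𝓝 s)}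

/-- The limit set `LIM(∑ y n)`: all limit (cluster) points of the sequence of partial sums. -/
def limitSet {E : Type*} [AddCommMonoid E] [TopologicalSpace E] (y : ℕ → E) : Set E :=
  {a | MapClusterPt a atTop (seriesPartialSum y)}

/-! Adding the exterior of the ball of radius `n` to `X` gives a preconnected set `Y n`: every
component of `X` reaches the exterior, which is itself connected because the dimension is at least
2. The rearrangement is built in stages. In stage `n` the partial sums travel from `t n` to `t (n +
1)` along an `ε n`-chain in `Y n`, with `ε n → 0` and the `t n` accumulating at every point of `X`.
Limit points then lie in `X`, since the exteriors recede to infinity and `X` is closed.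

Each step of a chain needs unused terms whose total is close to a given vector. As the sum range is
everything, some finite set containing the used indices has sum near the next chain point. The
Steinitz lemma orders its new terms, all of norm at most `ε`, so that the detour is at most a
dimensional constant times `ε`. -/

/-! ### The Steinitz lemma. -/

/-- A weight vector on a finite set `A` of vectors in `E`, with total mass
`|A| - dim E - 1` and weighted sum zero, may be chosen to vanish somewhere. -/
theorem exists_weight_eq_zero {ι E : Type*} [NormedAddCommGroup E] [NormedSpace ℝ E]
    [FiniteDimensional ℝ E] (A : Finset ι) (v : ι → E)
    (w : ι → ℝ) (hw : ∀ i ∈ A, w i ∈ Set.Icc (0 : ℝ) 1)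
    (hsum : ∑ i ∈ A, w i = A.card - Module.finrank ℝ E - 1)
    (hv : ∑ i ∈ A, w i • v i = 0) :
    ∃ u : ι → ℝ, (∀ i ∈ A, u i ∈ Set.Icc (0 : ℝ) 1) ∧
      ∑ i ∈ A, u i = A.card - Module.finrank ℝ E - 1 ∧ ∑ i ∈ A, u i • v i = 0 ∧
      ∃ i ∈ A, u i = 0 := by
  classical
  set c : ℝ := A.card - Module.finrank ℝ E - 1 with hc
  let K : Set (A → ℝ) := Set.Icc 0 1 ∩ {u | ∑ i, u i = c} ∩ {u | ∑ i, u i • v i = 0}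
  have hK : IsCompact K := by
    refine (isCompact_Icc.inter_right ?_).inter_right ?_
    · exact isClosed_eq (by fun_prop) (by fun_prop)
    · exact isClosed_eq (by fun_prop) (by fun_prop)
  have hne : K.Nonempty := by
    refine ⟨fun i => w i, ⟨⟨fun i => (hw i i.2).1, fun i => (hw i i.2).2⟩, ?_⟩, ?_⟩
    · exact (Finset.sum_coe_sort A w).trans hsum
    · exact (Finset.sum_coe_sort A (fun i => w i • v i)).trans hv
  -- An extreme point of this polytope must have a zero entry: otherwise enough entries lie strictly
  -- inside `(0, 1)` to perturb it both ways.
  obtain ⟨u, hu⟩ := hK.extremePoints_nonempty hne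
  obtain ⟨⟨⟨hu0, hu1⟩, hus⟩, huv⟩ := hu.1
  change ∑ i, u i = c at hus
  change ∑ i, u i • v i = 0 at huv
  by_cases hz : ∃ i, u i = 0
  · obtain ⟨j, hj⟩ := hz
    refine ⟨fun i => if h : i ∈ A then u ⟨i, h⟩ else 0, ?_, ?_, ?_, j, j.2, ?_⟩
    · intro i hi
      simpa [hi] using ⟨hu0 ⟨i, hi⟩, hu1 ⟨i, hi⟩⟩
    · rw [← Finset.sum_coe_sort A, ← hus]
      simp
    · rw [← Finset.sum_coe_sort A, ← huv]
      simp
    · simpa using hj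
  exfalso
  push Not at hz
  have hpos : ∀ i, 0 < u i := fun i => lt_of_le_of_ne (hu0 i) (hz i).symm
  let T : Finset A := Finset.univ.filter fun i => u i < 1
  have hT1 : ∀ i, i ∉ T → u i = 1 := by
    intro i hi
    have := hu1 i
    simp only [T, Finset.mem_filter, Finset.mem_univ, true_and, not_lt, Pi.one_apply] at *
    linarith
  have hdef : ∑ i ∈ T, (1 - u i) = Module.finrank ℝ E + 1 := by
    have h1 : ∑ i ∈ T, (1 - u i) = ∑ i, (1 - u i) := by
      refine Finset.sum_subset (Finset.subset_univ _) fun i _ hi => ?_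
      rw [hT1 i hi, sub_self]
    rw [h1, Finset.sum_sub_distrib, hus, hc]
    simp
    ring
  have hTcard : Module.finrank ℝ (E × ℝ) < T.card := by
    have hTne : T.Nonempty := by
      rw [Finset.nonempty_iff_ne_empty]
      intro h
      rw [h] at hdef
      simp at hdef
      linarith [(Nat.cast_nonneg (Module.finrank ℝ E) : (0 : ℝ) ≤ _)]
    -- The deficits `1 - u i` total `dim E + 1` and each is below 1, so there are more than `dim E +
    -- 1` of them.
    have : (Module.finrank ℝ E + 1 : ℝ) < T.card := by
      rw [← hdef]
      calc ∑ i ∈ T, (1 - u i) < ∑ i ∈ T, (1 : ℝ) :=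
            Finset.sum_lt_sum_of_nonempty hTne fun i _ => by linarith [hpos i]
        _ = T.card := by simp
    rw [Module.finrank_prod, Module.finrank_self]
    exact_mod_cast this
  obtain ⟨g, hg, hgne⟩ : ∃ g : A → ℝ, ∑ i ∈ T, g i • ((v i, 1) : E × ℝ) = 0 ∧
      ∃ i ∈ T, g i ≠ 0 := by
    have hli : ¬ LinearIndependent ℝ (fun i : T => ((v i, 1) : E × ℝ)) := by
      intro h
      have := h.fintype_card_le_finrank
      rw [Fintype.card_coe] at this
      omega
    rw [Fintype.not_linearIndependent_iff] at hli
    obtain ⟨g, hg, j, hj⟩ := hli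
    refine ⟨fun i => if h : i ∈ T then g ⟨i, h⟩ else 0, ?_, j, j.2, by simpa using hj⟩
    rw [← Finset.sum_coe_sort T, ← hg]
    simp
  let h : A → ℝ := fun i => if i ∈ T then g i else 0
  have hhs : ∑ i, h i = 0 := by
    have := congrArg Prod.snd hg
    simpa [-Finset.univ_eq_attach, h, Prod.snd_sum, Finset.sum_ite_mem] using this
  have hhv : ∑ i, h i • v i = 0 := by
    have := congrArg Prod.fst hg
    simpa [-Finset.univ_eq_attach, h, Prod.fst_sum, Finset.sum_ite_mem, ite_smul] using this
  have hev : ∀ᶠ t in 𝓝[>] (0 : ℝ), ∀ i, 0 ≤ u i + t * h i ∧ u i + t * h i ≤ 1 ∧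
      0 ≤ u i - t * h i ∧ u i - t * h i ≤ 1 := by
    rw [eventually_all]
    intro i
    by_cases hi : i ∈ T
    · apply eventually_nhdsWithin_of_eventually_nhds
      have hi' : u i < 1 := by simpa [T] using hi
      have c1 : Tendsto (fun t : ℝ => u i + t * h i) (𝓝 0) (𝓝 (u i)) := by
        have : Continuous (fun t : ℝ => u i + t * h i) := by fun_prop
        simpa using this.tendsto 0
      have c2 : Tendsto (fun t : ℝ => u i - t * h i) (𝓝 0) (𝓝 (u i)) := by
        have : Continuous (fun t : ℝ => u i - t * h i) := by fun_prop
        simpa using this.tendsto 0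
      filter_upwards [c1.eventually_const_lt (hpos i), c1.eventually_lt_const hi',
        c2.eventually_const_lt (hpos i), c2.eventually_lt_const hi'] with t h1 h2 h3 h4
      exact ⟨h1.le, h2.le, h3.le, h4.le⟩
    · refine Eventually.of_forall fun t => ?_
      simpa [h, hi] using And.intro (hu0 i) (And.intro (hu1 i) (And.intro (hu0 i) (hu1 i)))
  obtain ⟨t, ht, ht0⟩ := (hev.and self_mem_nhdsWithin).exists
  have ht0 : 0 < t := ht0
  have hp : ∀ s : ℝ, (∀ i, 0 ≤ u i + s * h i ∧ u i + s * h i ≤ 1) → u + s • h ∈ K := by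
    intro s hs
    refine ⟨⟨⟨fun i => (hs i).1, fun i => (hs i).2⟩, ?_⟩, ?_⟩
    · simp [-Finset.univ_eq_attach, Finset.sum_add_distrib, hus, ← Finset.mul_sum, hhs]
    · simp [-Finset.univ_eq_attach, add_smul, Finset.sum_add_distrib, huv, mul_smul, ← Finset.smul_sum, hhv]
  have k1 := hp t fun i => ⟨(ht i).1, (ht i).2.1⟩
  have k2 := hp (-t) fun i => by
    have := ht i
    constructor <;> linarith
  have hseg : u ∈ openSegment ℝ (u + t • h) (u + (-t) • h) := by
    refine ⟨1/2, 1/2, by norm_num, by norm_num, by norm_num, ?_⟩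
    ext i
    simp
    ring
  have := hu.2 k1 k2 hseg
  obtain ⟨j, hjT, hj⟩ := hgne
  have h2 := congrFun this j
  simp [h, hjT, hj, ht0.ne'] at h2

theorem norm_sum_le_length_mul {ι E : Type*} [SeminormedAddCommGroup E] (v : ι → E) (r : ℝ)
    (l : List ι) (h : ∀ i ∈ l, ‖v i‖ ≤ r) : ‖(l.map v).sum‖ ≤ l.length * r := by
  induction l with
  | nil => simp
  | cons a l ih =>
    have h1 := h a (by simp)
    have h2 := ih fun i hi => h i (by simp [hi])
    simp only [List.map_cons, List.sum_cons, List.length_cons, Nat.cast_add, Nat.cast_one]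
    linarith [norm_add_le (v a) (l.map v).sum]

/-- The order is chosen from the end: an index of weight zero goes last, and the weights restrict to
the remaining set. This stops at `dim E` vectors, where any order works. -/
theorem exists_list_of_weight {ι E : Type*} [NormedAddCommGroup E] [NormedSpace ℝ E]
    [FiniteDimensional ℝ E] (v : ι → E) (r : ℝ) (hr : 0 ≤ r) (N : ℕ) :
    ∀ (A : Finset ι), A.card = Module.finrank ℝ E + N → (∀ i ∈ A, ‖v i‖ ≤ r) →
    ∀ w : ι → ℝ, (∀ i ∈ A, w i ∈ Set.Icc (0 : ℝ) 1) → ∑ i ∈ A, w i = N →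
    ∑ i ∈ A, w i • v i = 0 →
    ∃ l : List ι, l.Nodup ∧ (∀ i, i ∈ l ↔ i ∈ A) ∧
      ∀ k, ‖((l.take k).map v).sum‖ ≤ Module.finrank ℝ E * r := by
  classical
  induction N with
  | zero =>
    intro A hA hAr w _ _ _
    refine ⟨A.toList, A.nodup_toList, fun i => Finset.mem_toList, fun k => ?_⟩
    refine (norm_sum_le_length_mul v r _ fun i hi => hAr i ?_).trans ?_
    · exact Finset.mem_toList.1 (List.mem_of_mem_take hi)
    · gcongr
      rw [List.length_take, Finset.length_toList, hA]
      simp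
  | succ N ih =>
    intro A hA hAr w hw hws hwv
    have hN : (0 : ℝ) < N + 1 := by positivity
    -- Scaling by `N / (N + 1)` lowers the mass from `N + 1` to `N`, which is `|A| - dim E - 1`.
    obtain ⟨u, hu, hus, huv, j, hjA, hj⟩ := exists_weight_eq_zero A v
      (fun i => (N / (N + 1) : ℝ) * w i) (fun i hi => ⟨mul_nonneg (by positivity) (hw i hi).1,
        mul_le_one₀ (by rw [div_le_one hN]; linarith) (hw i hi).1 (hw i hi).2⟩)
      (by
        rw [← Finset.mul_sum, hws, hA]
        push_cast
        field_simp
        ring)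
      (by simp [mul_smul, ← Finset.smul_sum, hwv])
    obtain ⟨l, hl, hlA, hlk⟩ := ih (A.erase j) (by rw [Finset.card_erase_of_mem hjA, hA]; omega)
      (fun i hi => hAr i (Finset.mem_of_mem_erase hi)) u
      (fun i hi => hu i (Finset.mem_of_mem_erase hi))
      (by rw [Finset.sum_erase _ hj, hus, hA]; push_cast; ring)
      (by rw [Finset.sum_erase _ (by simp [hj]), huv])
    have hjl : j ∉ l := by simp [hlA]
    have hmem : ∀ i, i ∈ l ++ [j] ↔ i ∈ A := by
      intro i
      by_cases hij : i = j <;> simp [hlA, hij, hjA]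
    have hnd : (l ++ [j]).Nodup := by
      rw [List.nodup_append]
      simp only [List.nodup_singleton, List.mem_singleton]
      exact ⟨hl, trivial, fun a ha b hb => by rintro rfl; exact hjl (hb ▸ ha)⟩
    refine ⟨l ++ [j], hnd, hmem, fun k => ?_⟩
    rcases Nat.lt_or_ge l.length k with hk | hk
    · rw [List.take_of_length_le (by simpa using hk)]
      have h1 : ((l ++ [j]).map v).sum = ∑ i ∈ A, v i := by
        rw [← List.sum_toFinset _ hnd]
        congr 1
        ext i
        rw [List.mem_toFinset, hmem]
      -- The weighted sum vanishes, and the coefficients `1 - w i` total exactly `dim E`.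
      have h2 : ∑ i ∈ A, v i = ∑ i ∈ A, (1 - w i) • v i := by
        simp [sub_smul, hwv]
      rw [h1, h2]
      calc ‖∑ i ∈ A, (1 - w i) • v i‖ ≤ ∑ i ∈ A, (1 - w i) * r := by
            refine norm_sum_le_of_le _ fun i hi => ?_
            have := hw i hi
            rw [norm_smul, Real.norm_of_nonneg (by linarith [this.2])]
            exact mul_le_mul_of_nonneg_left (hAr i hi) (by linarith [this.2])
        _ = Module.finrank ℝ E * r := by
            rw [← Finset.sum_mul, Finset.sum_sub_distrib, hws]
            simp [hA]
    · rw [List.take_append_of_le_length hk]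
      exact hlk k

/-- **Steinitz lemma**: finitely many vectors of norm at most `r` with sum zero can be ordered so
that all partial sums have norm at most `dim E * r`. -/
theorem steinitz_rearrangement {ι E : Type*} [NormedAddCommGroup E] [NormedSpace ℝ E]
    [FiniteDimensional ℝ E] (v : ι → E) (r : ℝ) (hr : 0 ≤ r) (A : Finset ι)
    (hA : ∀ i ∈ A, ‖v i‖ ≤ r) (hsum : ∑ i ∈ A, v i = 0) :
    ∃ l : List ι, l.Nodup ∧ (∀ i, i ∈ l ↔ i ∈ A) ∧
      ∀ k, ‖((l.take k).map v).sum‖ ≤ Module.finrank ℝ E * r := by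
  rcases Nat.lt_or_ge (Module.finrank ℝ E) A.card with h | h
  · have hc : (0 : ℝ) < A.card := by exact_mod_cast (by omega : 0 < A.card)
    obtain ⟨N, hN⟩ := Nat.exists_eq_add_of_lt h
    refine exists_list_of_weight v r hr (N + 1) A (by omega) hA
      (fun _ => ((N + 1 : ℕ) : ℝ) / A.card) (fun i _ => ⟨by positivity, ?_⟩) ?_ ?_
    · rw [div_le_one hc]
      exact_mod_cast (by omega : N + 1 ≤ A.card)
    · rw [Finset.sum_const, nsmul_eq_mul]
      field_simp
    · rw [← Finset.smul_sum, hsum, smul_zero]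
  · refine ⟨A.toList, A.nodup_toList, fun i => Finset.mem_toList, fun k => ?_⟩
    refine (norm_sum_le_length_mul v r _ fun i hi => hA i ?_).trans ?_
    · exact Finset.mem_toList.1 (List.mem_of_mem_take hi)
    · gcongr
      rw [List.length_take, Finset.length_toList]
      omega

/-- Finitely many vectors of norm at most `r` can be ordered so that the partial sums exceed the
norm of the total sum by at most `2 * dim E * r`. -/
theorem exists_list_norm_take_sum_le {ι E : Type*} [NormedAddCommGroup E] [NormedSpace ℝ E]
    [FiniteDimensional ℝ E] (v : ι → E) (r : ℝ) (hr : 0 ≤ r) (A : Finset ι)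
    (hA : ∀ i ∈ A, ‖v i‖ ≤ r) :
    ∃ l : List ι, l.Nodup ∧ (∀ i, i ∈ l ↔ i ∈ A) ∧
      ∀ k, ‖((l.take k).map v).sum‖ ≤ Module.finrank ℝ E * (2 * r) + ‖∑ i ∈ A, v i‖ := by
  classical
  rcases A.eq_empty_or_nonempty with rfl | hne
  · exact ⟨[], by simp, by simp, fun k => by simp; positivity⟩
  have hc : (0 : ℝ) < A.card := by exact_mod_cast hne.card_pos
  set S := ∑ i ∈ A, v i with hS
  -- Subtracting the mean makes the sum zero at the cost of doubling the bound `r`.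
  set a : E := (A.card : ℝ)⁻¹ • S with ha
  have hSn : ‖S‖ ≤ A.card * r := by
    simpa using norm_sum_le_of_le A hA
  have hna : A.card * ‖a‖ = ‖S‖ := by
    rw [ha, norm_smul, norm_inv, Real.norm_of_nonneg hc.le]
    field_simp
  have har : ‖a‖ ≤ r := le_of_mul_le_mul_left (hna.trans_le hSn) hc
  obtain ⟨l, hl, hlA, hlk⟩ := steinitz_rearrangement (fun i => v i - a) (2 * r) (by linarith) A
    (fun i hi => (norm_sub_le _ _).trans (by linarith [hA i hi]))
    (by
      rw [Finset.sum_sub_distrib, Finset.sum_const, ← hS, ha, ← Nat.cast_smul_eq_nsmul ℝ,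
        smul_inv_smul₀ hc.ne', sub_self])
  have hlen : l.length = A.card := by
    rw [← List.toFinset_card_of_nodup hl]
    congr 1
    ext i
    rw [List.mem_toFinset, hlA]
  have key : ∀ l' : List ι, (l'.map v).sum = (l'.map fun i => v i - a).sum + (l'.length : ℝ) • a := by
    intro l'
    induction l' with
    | nil => simp
    | cons b l' ih =>
      simp only [List.map_cons, List.sum_cons, ih, List.length_cons, Nat.cast_add, Nat.cast_one,
        add_smul, one_smul]
      abel
  refine ⟨l, hl, hlA, fun k => ?_⟩
  rw [key]
  refine (norm_add_le _ _).trans (add_le_add (hlk k) ?_)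
  rw [norm_smul, Real.norm_of_nonneg (Nat.cast_nonneg _), ← hna]
  gcongr
  rw [List.length_take, ← hlen]
  omega

/-! ### Chains and connectedness at infinity. -/

/-- Any two points of a preconnected set are joined by a chain in the set with steps at most `ε`. -/
theorem IsPreconnected.reflTransGen_dist_le {α : Type*} [PseudoMetricSpace α] {s : Set α}
    (hs : IsPreconnected s) {ε : ℝ} (hε : 0 < ε) {a b : α} (ha : a ∈ s) (hb : b ∈ s) :
    Relation.ReflTransGen (fun p q => q ∈ s ∧ dist p q ≤ ε) a b := by
  by_contra hab
  let R : α → Prop := fun p => Relation.ReflTransGen (fun p q => q ∈ s ∧ dist p q ≤ ε) a p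
  let U : Set α := ⋃ p ∈ {p | p ∈ s ∧ R p}, Metric.ball p ε
  let V : Set α := ⋃ p ∈ {p | p ∈ s ∧ ¬ R p}, Metric.ball p ε
  have hU : IsOpen U := isOpen_biUnion fun _ _ => Metric.isOpen_ball
  have hV : IsOpen V := isOpen_biUnion fun _ _ => Metric.isOpen_ball
  have hUV : s ⊆ U ∪ V := by
    intro p hp
    by_cases h : R p
    · exact Or.inl (Set.mem_biUnion (show p ∈ {p | p ∈ s ∧ R p} from ⟨hp, h⟩)
        (Metric.mem_ball_self hε))
    · exact Or.inr (Set.mem_biUnion (show p ∈ {p | p ∈ s ∧ ¬ R p} from ⟨hp, h⟩)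
        (Metric.mem_ball_self hε))
  -- A common point `z` of the two neighbourhoods links a reachable point to an unreachable one in
  -- two steps.
  obtain ⟨z, hz, hzU, hzV⟩ := hs U V hU hV hUV
    ⟨a, ha, Set.mem_biUnion (show a ∈ {p | p ∈ s ∧ R p} from ⟨ha, .refl⟩)
      (Metric.mem_ball_self hε)⟩
    ⟨b, hb, Set.mem_biUnion (show b ∈ {p | p ∈ s ∧ ¬ R p} from ⟨hb, hab⟩)
      (Metric.mem_ball_self hε)⟩
  simp only [U, V, Set.mem_iUnion] at hzU hzV
  obtain ⟨p, ⟨hp, hRp⟩, hzp⟩ := hzU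
  obtain ⟨q, ⟨hq, hRq⟩, hzq⟩ := hzV
  refine hRq ((hRp.tail ⟨hz, ?_⟩).tail ⟨hq, ?_⟩)
  · rw [dist_comm]
    exact (Metric.mem_ball.1 hzp).le
  · exact (Metric.mem_ball.1 hzq).le

theorem isPreconnected_setOf_le_norm {E : Type*} [NormedAddCommGroup E] [NormedSpace ℝ E]
    (h : 1 < Module.rank ℝ E) (r : ℝ) : IsPreconnected {z : E | r ≤ ‖z‖} := by
  rcases le_or_gt r 0 with hr | hr
  · have : {z : E | r ≤ ‖z‖} = Set.univ := Set.eq_univ_of_forall fun z => hr.trans (norm_nonneg z)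
    rw [this]
    exact isPreconnected_univ
  have himg : {z : E | r ≤ ‖z‖} =
      (fun q : ℝ × E => q.1 • q.2) '' (Set.Ici r ×ˢ Metric.sphere (0 : E) 1) := by
    ext z
    constructor
    · intro hz
      have hz : r ≤ ‖z‖ := hz
      have hz0 : ‖z‖ ≠ 0 := (hr.trans_le hz).ne'
      refine ⟨(‖z‖, ‖z‖⁻¹ • z), ⟨hz, ?_⟩, smul_inv_smul₀ hz0 z⟩
      simp [norm_smul, hz0]
    · rintro ⟨⟨t, y⟩, ⟨ht, hy⟩, rfl⟩
      have ht : r ≤ t := ht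
      have hy : ‖y‖ = 1 := by simpa using hy
      change r ≤ ‖t • y‖
      rw [norm_smul, hy, mul_one]
      exact ht.trans (le_abs_self t)
  rw [himg]
  exact (isPreconnected_Ici.prod (isPreconnected_sphere h 0 1)).image _ (by fun_prop)

/-- A set with unbounded components becomes preconnected after adding the complement of a ball. -/
theorem isPreconnected_union_setOf_le_norm {E : Type*} [NormedAddCommGroup E] [NormedSpace ℝ E]
    (h : 1 < Module.rank ℝ E) (X : Set E)
    (hcomp : ∀ a ∈ X, ¬ Bornology.IsBounded (connectedComponentIn X a)) (r : ℝ) :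
    IsPreconnected (X ∪ {z : E | r ≤ ‖z‖}) := by
  have key : ∀ a ∈ X ∪ {z : E | r ≤ ‖z‖}, ∃ C ⊆ X ∪ {z : E | r ≤ ‖z‖}, a ∈ C ∧
      {z : E | r ≤ ‖z‖} ⊆ C ∧ IsPreconnected C := by
    rintro a (ha | ha)
    · obtain ⟨b, hb, hbr⟩ : ∃ b ∈ connectedComponentIn X a, r ≤ ‖b‖ := by
        by_contra! hcon
        exact hcomp a ha (isBounded_iff_forall_norm_le.2 ⟨r, fun b hb => (hcon b hb).le⟩)
      refine ⟨connectedComponentIn X a ∪ {z : E | r ≤ ‖z‖},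
        Set.union_subset_union_left _ (connectedComponentIn_subset X a),
        Or.inl (mem_connectedComponentIn ha), Set.subset_union_right, ?_⟩
      exact isPreconnected_connectedComponentIn.union b hb hbr (isPreconnected_setOf_le_norm h r)
    · exact ⟨_, Set.subset_union_right, ha, subset_rfl, isPreconnected_setOf_le_norm h r⟩
  obtain ⟨z, hz⟩ : ∃ z : E, r ≤ ‖z‖ := by
    have : Nontrivial E := by
      apply (rank_pos_iff_nontrivial (R := ℝ)).1
      exact zero_lt_one.trans h
    obtain ⟨z, hz⟩ := NormedSpace.exists_lt_norm ℝ E r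
    exact ⟨z, hz.le⟩
  refine isPreconnected_of_forall z fun a ha => ?_
  obtain ⟨C, hC, haC, hrC, hCp⟩ := key a ha
  exact ⟨C, hC, hrC hz, haC, hCp⟩

/-! ### Steering finite partial sums. -/

theorem sum_map_eq_sum_finset {ι E : Type*} [DecidableEq ι] [AddCommMonoid E] (x : ι → E)
    {l : List ι} (hl : l.Nodup) {A : Finset ι} (hA : ∀ i, i ∈ l ↔ i ∈ A) :
    (l.map x).sum = ∑ i ∈ A, x i := by
  rw [← List.sum_toFinset _ hl]
  congr 1
  ext i
  rw [List.mem_toFinset, hA]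

theorem tendsto_zero_of_mem_sumRange {E : Type*} [NormedAddCommGroup E] {x : ℕ → E} {s : E}
    (hs : s ∈ sumRange x) : Tendsto x atTop (𝓝 0) := by
  obtain ⟨σ, hσ⟩ := hs
  have h1 : Tendsto (fun n => x (σ n)) atTop (𝓝 0) := by
    have := (hσ.comp (tendsto_add_atTop_nat 1)).sub hσ
    rw [sub_self] at this
    refine this.congr fun n => ?_
    simp [seriesPartialSum, Finset.sum_range_succ]
  have h2 : Tendsto σ.symm atTop atTop := by
    rw [← Nat.cofinite_eq_atTop]
    exact σ.symm.injective.tendsto_cofinite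
  refine (h1.comp h2).congr fun n => by simp

/-- If `q` is in the sum range, some finite set containing a prescribed one has sum close to `q`. -/
theorem exists_finset_sum_near {E : Type*} [NormedAddCommGroup E] {x : ℕ → E} {q : E}
    (hq : q ∈ sumRange x) (D : Finset ℕ) {δ : ℝ} (hδ : 0 < δ) :
    ∃ G : Finset ℕ, D ⊆ G ∧ dist (∑ i ∈ G, x i) q ≤ δ := by
  classical
  obtain ⟨σ, hσ⟩ := hq
  have h1 : ∀ᶠ k in atTop, D ⊆ (Finset.range k).map σ.toEmbedding := by
    obtain ⟨N, hN⟩ := (D.map σ.symm.toEmbedding).exists_nat_subset_range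
    filter_upwards [eventually_ge_atTop N] with k hk i hi
    have : σ.symm i ∈ Finset.range N := hN (by simpa using hi)
    simp only [Finset.mem_map, Finset.mem_range] at this ⊢
    exact ⟨σ.symm i, by omega, by simp⟩
  obtain ⟨k, hk, hk2⟩ := (h1.and (Metric.tendsto_nhds.1 hσ δ hδ)).exists
  refine ⟨_, hk, ?_⟩
  rw [Finset.sum_map]
  exact hk2.le

/-- Extend a finite list containing all indices of large terms so that the partial sums move to a
nearby target without making a large excursion, using up any prescribed finite set of indices. -/
theorem exists_append_near {E : Type*} [NormedAddCommGroup E] [NormedSpace ℝ E]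
    [FiniteDimensional ℝ E] {x : ℕ → E} (hx : sumRange x = Set.univ) {ε : ℝ} (hε : 0 < ε)
    {l : List ℕ} (hl : l.Nodup) (hlε : ∀ n, ε < ‖x n‖ → n ∈ l) (q : E)
    (hq : dist (l.map x).sum q ≤ 2 * ε) (D : Finset ℕ) {δ : ℝ} (hδ : 0 < δ) :
    ∃ l' : List ℕ, (l ++ l').Nodup ∧ (∀ n ∈ D, n ∈ l ++ l') ∧
      dist ((l ++ l').map x).sum q ≤ δ ∧
      ∀ k, dist ((l ++ l'.take k).map x).sum q ≤ (2 * Module.finrank ℝ E + 5) * ε := by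
  classical
  obtain ⟨G, hG, hGq⟩ := exists_finset_sum_near (x := x) (q := q) (by simp [hx])
    (D ∪ l.toFinset) (lt_min hδ hε)
  obtain ⟨l', hl', hl'A, hk⟩ := exists_list_norm_take_sum_le x ε hε.le (G \ l.toFinset) (by
    intro i hi
    by_contra! hcon
    have := hlε i hcon
    simp_all)
  have hlG : ∀ i ∈ l, i ∈ G := fun i hi => hG (by simp [hi])
  have hnd : (l ++ l').Nodup := by
    rw [List.nodup_append']
    refine ⟨hl, hl', fun i hi hi' => ?_⟩
    rw [hl'A] at hi'
    simp_all
  have hmem : ∀ i, i ∈ l ++ l' ↔ i ∈ G := by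
    intro i
    by_cases hi : i ∈ l
    · simp [hi, hlG i hi]
    · simp [hl'A, hi]
  have hsum : ((l ++ l').map x).sum = ∑ i ∈ G, x i := sum_map_eq_sum_finset x hnd hmem
  have hsum' : (l.map x).sum + ∑ i ∈ G \ l.toFinset, x i = ∑ i ∈ G, x i := by
    rw [← hsum, List.map_append, List.sum_append, sum_map_eq_sum_finset x hl' hl'A]
  refine ⟨l', hnd, fun n hn => (hmem n).2 (hG (by simp [hn])), ?_, fun k => ?_⟩
  · rw [hsum]
    exact hGq.trans (min_le_left _ _)
  -- The constant is `2 * dim E + 3 + 2`: ordering cost, total displacement, and initial distance to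
  -- `q`.
  · have h1 : ‖∑ i ∈ G \ l.toFinset, x i‖ ≤ 3 * ε := by
      rw [← eq_sub_iff_add_eq'] at hsum'
      rw [hsum', ← dist_eq_norm]
      refine (dist_triangle _ q _).trans ?_
      have h3 := hGq.trans (min_le_right _ _)
      rw [dist_comm q]
      linarith
    have h2 := hk k
    rw [List.map_append, List.sum_append, dist_eq_norm, add_sub_right_comm]
    refine (norm_add_le _ _).trans ?_
    rw [← dist_eq_norm]
    linarith

/-- Extend a finite list so that the partial sums follow a preconnected set to a target point. -/
theorem exists_append_along {E : Type*} [NormedAddCommGroup E] [NormedSpace ℝ E]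
    [FiniteDimensional ℝ E] {x : ℕ → E} (hx : sumRange x = Set.univ) {Y : Set E}
    (hY : IsPreconnected Y) {ε : ℝ} (hε : 0 < ε)
    {l : List ℕ} (hl : l.Nodup) (hlε : ∀ n, ε < ‖x n‖ → n ∈ l) {a b : E} (ha : a ∈ Y) (hb : b ∈ Y)
    (hla : dist (l.map x).sum a ≤ ε) (D : Finset ℕ) {δ : ℝ} (hδ : 0 < δ) :
    ∃ l' : List ℕ, (l ++ l').Nodup ∧ (∀ n ∈ D, n ∈ l ++ l') ∧
      dist ((l ++ l').map x).sum b ≤ δ ∧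
      ∀ k, ∃ y ∈ Y, dist ((l ++ l'.take k).map x).sum y ≤ (2 * Module.finrank ℝ E + 5) * ε := by
  have hCε : ε ≤ (2 * Module.finrank ℝ E + 5) * ε :=
    le_mul_of_one_le_left hε.le (by linarith [(Nat.cast_nonneg (Module.finrank ℝ E) : (0 : ℝ) ≤ _)])
  have extend : ∀ {l₁ l₂ : List ℕ} {z : E}, z ∈ Y →
      (∀ k, ∃ y ∈ Y, dist ((l ++ l₁.take k).map x).sum y ≤ (2 * Module.finrank ℝ E + 5) * ε) →
      (∀ k, dist ((l ++ l₁ ++ l₂.take k).map x).sum z ≤ (2 * Module.finrank ℝ E + 5) * ε) →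
      ∀ k, ∃ y ∈ Y,
        dist ((l ++ (l₁ ++ l₂).take k).map x).sum y ≤ (2 * Module.finrank ℝ E + 5) * ε := by
    intro l₁ l₂ z hz h₁ h₂ k
    rcases le_total k l₁.length with hk | hk
    · rw [List.take_append_of_le_length hk]
      exact h₁ k
    · refine ⟨z, hz, ?_⟩
      rw [List.take_append, List.take_of_length_le hk, ← List.append_assoc]
      exact h₂ _
  have chain : ∃ l' : List ℕ, (l ++ l').Nodup ∧ dist ((l ++ l').map x).sum b ≤ ε ∧
      ∀ k, ∃ y ∈ Y, dist ((l ++ l'.take k).map x).sum y ≤ (2 * Module.finrank ℝ E + 5) * ε := by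
    have hab := hY.reflTransGen_dist_le hε ha hb
    clear hb
    induction hab with
    | refl => exact ⟨[], by simpa, by simpa, fun k => ⟨a, ha, by simpa using hla.trans hCε⟩⟩
    | @tail p q _ hpq ih =>
      obtain ⟨l₁, hl₁, hp, hk₁⟩ := ih
      obtain ⟨l₂, hl₂, -, hq, hk₂⟩ := exists_append_near hx hε hl₁
        (fun n hn => List.mem_append_left _ (hlε n hn)) q
        (by linarith [dist_triangle ((l ++ l₁).map x).sum p q, hpq.2]) ∅ hε
      refine ⟨l₁ ++ l₂, ?_, ?_, extend hpq.1 hk₁ hk₂⟩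
      · rwa [← List.append_assoc]
      · rwa [← List.append_assoc]
  obtain ⟨l₁, hl₁, hp, hk₁⟩ := chain
  obtain ⟨l₂, hl₂, hD, hq, hk₂⟩ := exists_append_near hx hε hl₁
    (fun n hn => List.mem_append_left _ (hlε n hn)) b (by linarith) D hδ
  refine ⟨l₁ ++ l₂, ?_, ?_, ?_, extend hb hk₁ hk₂⟩
  · rwa [← List.append_assoc]
  · rwa [← List.append_assoc]
  · rwa [← List.append_assoc]

/-! ### Assembling the permutation. -/

/-- A growing sequence of duplicate-free lists exhausting `ℕ` is the sequence of initial segments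
of a permutation. -/
theorem exists_perm_of_prefix_lists (L : ℕ → List ℕ) (hpre : ∀ n, L n <+: L (n + 1))
    (hnd : ∀ n, (L n).Nodup) (hmem : ∀ n, ∀ i < n, i ∈ L n) :
    ∃ σ : Equiv.Perm ℕ, ∀ n k, k ≤ (L n).length → (List.range k).map σ = (L n).take k := by
  have hmono : ∀ {a b}, a ≤ b → L a <+: L b := fun {a b} hab =>
    Nat.le_induction (List.prefix_refl _) (fun n _ ih => ih.trans (hpre n)) b hab
  have hlen : ∀ n, n ≤ (L n).length := by
    intro n
    rw [← List.toFinset_card_of_nodup (hnd n)]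
    calc n = (Finset.range n).card := by simp
      _ ≤ _ := Finset.card_le_card fun i hi => by
        simpa using hmem n i (Finset.mem_range.1 hi)
  let s : ℕ → ℕ := fun k => (L (k + 1))[k]'(hlen (k + 1))
  have hs : ∀ n k (h : k < (L n).length), s k = (L n)[k] := by
    intro n k h
    rcases le_total n (k + 1) with h' | h'
    · exact ((hmono h').getElem h).symm
    · exact (hmono h').getElem _
  have hbij : Function.Bijective s := by
    constructor
    · intro a b hab
      have ha : a < (L (a + b + 1)).length := lt_of_lt_of_le (by omega) (hlen _)
      have hb : b < (L (a + b + 1)).length := lt_of_lt_of_le (by omega) (hlen _)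
      rw [hs _ a ha, hs _ b hb] at hab
      exact (hnd _).getElem_inj_iff.1 hab
    · intro i
      obtain ⟨k, hk, hki⟩ := List.getElem_of_mem (hmem (i + 1) i (by omega))
      exact ⟨k, (hs _ k hk).trans hki⟩
  refine ⟨Equiv.ofBijective s hbij, fun n k hk => List.ext_getElem (by simpa using hk) ?_⟩
  intro j h₁ h₂
  simp only [List.getElem_map, List.getElem_range, List.getElem_take, Equiv.ofBijective_apply]
  exact hs n j _

theorem seriesPartialSum_eq_sum_map {E : Type*} [AddCommMonoid E] (x : ℕ → E) (σ : ℕ → ℕ) (k : ℕ) :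
    seriesPartialSum (fun n => x (σ n)) k = (((List.range k).map σ).map x).sum := by
  rw [List.map_map]
  rfl

/-- Target points in the sets `X ∪ {z | n ≤ ‖z‖}` accumulating at every point of `X`. -/
theorem exists_seq_mem_frequently_dist_lt {E : Type*} [NormedAddCommGroup E] [NormedSpace ℝ E]
    [Nontrivial E] [SecondCountableTopology E] (X : Set E) :
    ∃ t : ℕ → E, (∀ n : ℕ, t n ∈ X ∪ {z : E | (n : ℝ) ≤ ‖z‖}) ∧
      ∀ p ∈ X, ∀ r > 0, ∃ᶠ n : ℕ in atTop, dist (t n) p < r := by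
  rcases X.eq_empty_or_nonempty with rfl | hne
  · choose t ht using fun n : ℕ => NormedSpace.exists_lt_norm ℝ E n
    exact ⟨t, fun n => Or.inr (ht n).le, by simp⟩
  · have := hne.to_subtype
    -- Unpairing repeats each member of the dense sequence infinitely often.
    refine ⟨fun n => TopologicalSpace.denseSeq X (Nat.unpair n).1, fun n => Or.inl (Subtype.prop _),
      fun p hp r hr => ?_⟩
    obtain ⟨j, hj⟩ := (TopologicalSpace.denseRange_denseSeq X).exists_dist_lt ⟨p, hp⟩ hr
    rw [frequently_atTop]
    intro N
    refine ⟨Nat.pair j N, Nat.right_le_pair j N, ?_⟩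
    rw [dist_comm]
    simpa [Subtype.dist_eq] using hj

/-- Rearrangement whose partial sums visit all points `t n`, staying in between close to the
sets `Y n`. -/
theorem exists_perm_near_sets {E : Type*} [NormedAddCommGroup E] [NormedSpace ℝ E]
    [FiniteDimensional ℝ E] {x : ℕ → E} (hx : sumRange x = Set.univ) {Y : ℕ → Set E}
    (hY : ∀ n, IsPreconnected (Y n)) (hYanti : Antitone Y) {t : ℕ → E} (ht : ∀ n, t n ∈ Y n)
    {ε : ℕ → ℝ} (hε : ∀ n, 0 < ε n) :
    ∃ (σ : Equiv.Perm ℕ) (K : ℕ → ℕ), Monotone K ∧ (∀ n, n ≤ K n) ∧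
      (∀ n, dist (seriesPartialSum (fun i => x (σ i)) (K n)) (t n) ≤ ε n) ∧
      ∀ n k, K n ≤ k → k ≤ K (n + 1) → ∃ y ∈ Y n,
        dist (seriesPartialSum (fun i => x (σ i)) k) y ≤ (2 * Module.finrank ℝ E + 5) * ε n := by
  classical
  have hx0 : Tendsto x atTop (𝓝 0) := tendsto_zero_of_mem_sumRange (s := 0) (by simp [hx])
  have hbig : ∀ n, ∃ B : Finset ℕ, ∀ i, ε n < ‖x i‖ → i ∈ B := by
    intro n
    obtain ⟨N, hN⟩ := eventually_atTop.1 (Metric.tendsto_nhds.1 hx0 (ε n) (hε n))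
    refine ⟨Finset.range N, fun i hi => ?_⟩
    rw [Finset.mem_range]
    by_contra! hcon
    have := hN i hcon
    rw [dist_zero_right] at this
    linarith
  choose B hB using hbig
  -- `Finset.range n` forces every index to be used eventually; `B n` leaves only terms of norm at
  -- most `ε n` for stage `n`.
  let P : ℕ → List ℕ → Prop := fun n l => l.Nodup ∧ (∀ i ∈ Finset.range n ∪ B n, i ∈ l) ∧
    dist (l.map x).sum (t n) ≤ ε n
  have hzero : ∃ l, P 0 l := by
    obtain ⟨G, hG, hGt⟩ := exists_finset_sum_near (x := x) (q := t 0) (by simp [hx])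
      (Finset.range 0 ∪ B 0) (hε 0)
    refine ⟨G.toList, G.nodup_toList, fun i hi => Finset.mem_toList.2 (hG hi), ?_⟩
    rwa [sum_map_eq_sum_finset x G.nodup_toList fun i => Finset.mem_toList]
  have hsucc : ∀ n (l : {l // P n l}), ∃ l' : List ℕ, P (n + 1) (l ++ l') ∧
      ∀ k, ∃ y ∈ Y n, dist ((l ++ l'.take k).map x).sum y ≤
        (2 * Module.finrank ℝ E + 5) * ε n := by
    rintro n ⟨l, hl, hlm, hlt⟩
    obtain ⟨l', h1, h2, h3, h4⟩ := exists_append_along hx (hY n) (hε n) hl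
      (fun i hi => hlm i (Finset.mem_union_right _ (hB n i hi))) (ht n)
      (hYanti n.le_succ (ht (n + 1))) hlt (Finset.range (n + 1) ∪ B (n + 1)) (hε (n + 1))
    exact ⟨l', ⟨h1, h2, h3⟩, h4⟩
  choose f hf hfk using hsucc
  obtain ⟨l₀, hl₀⟩ := hzero
  let L : ∀ n, {l // P n l} := fun n =>
    Nat.rec ⟨l₀, hl₀⟩ (fun n l => ⟨l.1 ++ f n l, hf n l⟩) n
  have hLs : ∀ n, (L (n + 1)).1 = (L n).1 ++ f n (L n) := fun n => rfl
  obtain ⟨σ, hσ⟩ := exists_perm_of_prefix_lists (fun n => (L n).1)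
    (fun n => by rw [hLs]; exact List.prefix_append _ _) (fun n => (L n).2.1)
    (fun n i hi => (L n).2.2.1 i (Finset.mem_union_left _ (Finset.mem_range.2 hi)))
  have hS : ∀ n k, k ≤ (L n).1.length →
      seriesPartialSum (fun i => x (σ i)) k = (((L n).1.take k).map x).sum := by
    intro n k hk
    rw [seriesPartialSum_eq_sum_map, hσ n k hk]
  refine ⟨σ, fun n => (L n).1.length,
    monotone_nat_of_le_succ fun n => by simp [hLs], fun n => ?_, fun n => ?_, fun n k hk hk' => ?_⟩
  · change n ≤ (L n).1.length
    rw [← List.toFinset_card_of_nodup (L n).2.1]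
    calc n = (Finset.range n).card := by simp
      _ ≤ _ := Finset.card_le_card fun i hi => by
        simpa using (L n).2.2.1 i (Finset.mem_union_left _ hi)
  · rw [hS n _ le_rfl, List.take_length]
    exact (L n).2.2.2
  · rw [hS (n + 1) k hk', hLs, List.take_append, List.take_of_length_le hk]
    exact hfk n (L n) _

/-! ### The limit set. -/

theorem corollary6p6 (m : ℕ) (hm : 2 ≤ m) (x : ℕ → EuclideanSpace ℝ (Fin m))
    (hx : sumRange x = Set.univ) (X : Set (EuclideanSpace ℝ (Fin m))) (hX : IsClosed X)
    (hcomp : ∀ a ∈ X, ¬ Bornology.IsBounded (connectedComponentIn X a)) :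
    ∃ σ : Equiv.Perm ℕ, X = limitSet (fun n => x (σ n)) := by
  have hrank : 1 < Module.rank ℝ (EuclideanSpace ℝ (Fin m)) := by
    rw [← Module.finrank_eq_rank, finrank_euclideanSpace_fin]
    exact_mod_cast hm
  have : Nontrivial (EuclideanSpace ℝ (Fin m)) :=
    (rank_pos_iff_nontrivial (R := ℝ)).1 (zero_lt_one.trans hrank)
  obtain ⟨t, htY, htX⟩ := exists_seq_mem_frequently_dist_lt X
  obtain ⟨σ, K, hKm, hK, hKt, hKY⟩ := exists_perm_near_sets hx
    (fun n : ℕ => isPreconnected_union_setOf_le_norm hrank X hcomp n)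
    (fun a b hab => Set.union_subset_union_right _ fun z (hz : (b : ℝ) ≤ ‖z‖) =>
      (Nat.cast_le.2 hab).trans hz) htY
    (ε := fun n => 1 / ((n : ℝ) + 1)) (fun n => by positivity)
  set S := seriesPartialSum fun i => x (σ i) with hSdef
  set C : ℝ := 2 * Module.finrank ℝ (EuclideanSpace ℝ (Fin m)) + 5 with hC
  have htail : ∀ N k, K N ≤ k → ∃ n ≥ N, ∃ y ∈ X ∪ {z | (n : ℝ) ≤ ‖z‖},
      dist (S k) y ≤ C * (1 / ((n : ℝ) + 1)) := by
    intro N k hk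
    have : ∀ M ≥ N, k ≤ K M → ∃ n ≥ N, ∃ y ∈ X ∪ {z | (n : ℝ) ≤ ‖z‖},
        dist (S k) y ≤ C * (1 / ((n : ℝ) + 1)) := by
      intro M hM
      induction M, hM using Nat.le_induction with
      | base => exact fun h => ⟨N, le_rfl, hKY N k hk (h.trans (hKm N.le_succ))⟩
      | succ M hM ih =>
        intro h
        rcases le_total k (K M) with h' | h'
        · exact ih h'
        · exact ⟨M, hM, hKY M k h' h⟩
    exact this (max N k) (le_max_left _ _) ((le_max_right N k).trans (hK _))
  refine ⟨σ, Set.Subset.antisymm (fun p hp => ?_) fun p hp => ?_⟩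
  · refine (Metric.nhds_basis_ball.mapClusterPt_iff_frequently).2 fun r hr => ?_
    rw [frequently_atTop]
    intro N
    obtain ⟨n₀, hn₀⟩ := exists_nat_one_div_lt (half_pos hr)
    obtain ⟨n, hn, hnt⟩ := frequently_atTop.1 (htX p hp (r / 2) (half_pos hr)) (max N n₀)
    refine ⟨K n, ((le_max_left _ _).trans hn).trans (hK n), ?_⟩
    have h1 : 1 / ((n : ℝ) + 1) ≤ 1 / ((n₀ : ℝ) + 1) :=
      one_div_le_one_div_of_le (by positivity)
        (by have : (n₀ : ℝ) ≤ n := Nat.cast_le.2 ((le_max_right _ _).trans hn); linarith)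
    rw [Metric.mem_ball]
    linarith [dist_triangle (S (K n)) (t n) p, hKt n]
  · by_contra hpX
    obtain ⟨r, hr, hrX⟩ := Metric.isOpen_iff.1 hX.isOpen_compl p hpX
    have hCpos : 0 < C := by positivity
    obtain ⟨n₀, hn₀⟩ := exists_nat_one_div_lt (div_pos (half_pos hr) hCpos)
    -- Beyond this radius the exterior misses the ball of radius `r` about `p`, as `X` does.
    obtain ⟨n₁, hn₁⟩ := exists_nat_ge (‖p‖ + r)
    obtain ⟨k, hk, hkp⟩ := frequently_atTop.1
      ((Metric.nhds_basis_ball.mapClusterPt_iff_frequently).1 hp (r / 2) (half_pos hr))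
      (K (max n₀ n₁))
    obtain ⟨n, hn, y, hy, hky⟩ := htail _ k hk
    have h1 : C * (1 / ((n : ℝ) + 1)) < r / 2 := by
      rw [← lt_div_iff₀' hCpos]
      refine lt_of_le_of_lt (one_div_le_one_div_of_le (by positivity) ?_) hn₀
      have : (n₀ : ℝ) ≤ n := Nat.cast_le.2 ((le_max_left _ _).trans hn)
      linarith
    have hyp : dist y p < r := by
      have h2 : dist (S k) p < r / 2 := hkp
      linarith [dist_triangle_left y p (S k)]
    rcases hy with hy | hy
    · exact hrX (Metric.mem_ball.2 hyp) hy
    · have h3 : (n : ℝ) ≤ ‖y‖ := hy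
      have h4 : (n₁ : ℝ) ≤ n := Nat.cast_le.2 ((le_max_right _ _).trans hn)
      have h5 : ‖y‖ ≤ ‖p‖ + dist y p := by
        rw [dist_eq_norm]
        exact norm_le_norm_add_norm_sub' y p
      linarith
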